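/- All graphs are finite and simple. A star coloring of a graph $G$ is a proper coloring of its vertices in which the union of any two color classes induces a forest all of whose components are stars. The star choice number $\mathit{ch}_s(G)$ is the minimum $k$ such that, whenever every vertex $v$ of $G$ is given a list $L(v)$ of at least $k$ colors, $G$ has a star coloring in which every vertex $v$ receives a color from $L(v)$. The arrangeability of $G$ is the least integer $k\ge 0$ for which there is a linear ordering $\prec$ of the vertices of $G$ such that, for each vertex $v$, there are at most $k$ vertices $w\prec v$ that have a common neighbor $x$ with $v$ such that $v\prec x$. Let $\mathcal{F}$ be a class of graphs. Then there is a constant $k$ with $\mathit{ch}_s(G)\le k$ for all $G\in\mathcal{F}$ if and only if there is a constant $k$ such that every $G\in\mathcal{F}$ has arrangeability at most $k$. Moreover, for every integer $k\ge 0$, every graph $G$ of arrangeability at most $k$ satisfies $\mathit{ch}_s(G)\le (k+2)^2$. -/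

import Mathlib

universe u

namespace SimpleGraph

/-- Every connected component of `G` is a star: there is a centre `r` such that the edges of the
component are exactly the pairs formed by `r` and another vertex. An isolated vertex and a single
edge are stars. -/
def IsStarForest {V : Type*} (G : SimpleGraph V) : Prop :=
  ∀ C : G.ConnectedComponent, ∃ r : C, C.toSimpleGraph = starGraph r

/-- A star coloring is a proper coloring (`G.Coloring α` is Mathlib's type of proper colorings)
in which the union of any two color classes induces a forest of stars. -/
def IsStarColoring {V α : Type*} {G : SimpleGraph V} (c : G.Coloring α) : Prop :=
  ∀ a b : α, a ≠ b → (G.induce (c.colorClass a ∪ c.colorClass b)).IsStarForest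

/-- If every vertex gets a list of at least `k` colors, then there is a star coloring in which
every vertex has a color from its list. For finite graphs it makes no difference that
colors are natural numbers. -/
def IsStarChoosable {V : Type*} (G : SimpleGraph V) (k : ℕ) : Prop :=
  ∀ L : V → Finset ℕ, (∀ v, k ≤ (L v).card) →
    ∃ c : G.Coloring ℕ, IsStarColoring c ∧ ∀ v, c v ∈ L v

/-- The star choice number; the minimum is attained for every finite graph, see
`isStarChoosable_starChoiceNumber`. -/
noncomputable def starChoiceNumber {V : Type*} (G : SimpleGraph V) : ℕ :=
  sInf {k | G.IsStarChoosable k}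

/-- There is a linear ordering of the vertices such that for each vertex `v` there are at most `k`
vertices `w` smaller than `v` that have a common neighbor `x` with `v` such that `v` is smaller
than `x`. -/
def HasArrangement {V : Type*} (G : SimpleGraph V) (k : ℕ) : Prop :=
  ∃ _ : LinearOrder V, ∀ v : V, {w | w < v ∧ ∃ x, v < x ∧ G.Adj w x ∧ G.Adj v x}.encard ≤ k

/-- The arrangeability; the minimum is attained for every finite graph, see
`hasArrangement_arrangeability`. -/
noncomputable def arrangeability {V : Type*} (G : SimpleGraph V) : ℕ :=
  sInf {k | G.HasArrangement k}

section Attained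

variable {V : Type*} {G : SimpleGraph V}

theorem IsStarChoosable.mono {k l : ℕ} (h : G.IsStarChoosable k) (hkl : k ≤ l) :
    G.IsStarChoosable l :=
  fun L hL => h L fun v => hkl.trans (hL v)

theorem HasArrangement.mono {k l : ℕ} (h : G.HasArrangement k) (hkl : k ≤ l) :
    G.HasArrangement l := by
  obtain ⟨o, ho⟩ := h
  exact ⟨o, fun v => (ho v).trans (by exact_mod_cast hkl)⟩

theorem isStarColoring_of_injective {α : Type*} (c : G.Coloring α)
    (hc : Function.Injective c) : IsStarColoring c := by
  intro a b _ C
  obtain ⟨r, hr⟩ := C.nonempty_supp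
  have key : ∀ x y z : ↥(c.colorClass a ∪ c.colorClass b), x ≠ y → x ≠ z → y = z := by
    rintro ⟨x, hx⟩ ⟨y, hy⟩ ⟨z, hz⟩ hxy hxz
    have hx' : c x = a ∨ c x = b := hx
    have hy' : c y = a ∨ c y = b := hy
    have hz' : c z = a ∨ c z = b := hz
    simp only [ne_eq, Subtype.mk.injEq] at hxy hxz ⊢
    rw [← hc.eq_iff] at hxy hxz ⊢
    grind
  have adj : ∀ y ∈ C.supp, r ≠ y → (G.induce (c.colorClass a ∪ c.colorClass b)).Adj r y := by
    intro y hy hne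
    obtain ⟨p⟩ := ConnectedComponent.exact (hr.trans hy.symm)
    cases p with
    | nil => exact absurd rfl hne
    | cons h q => exact key _ _ _ h.ne hne ▸ h
  refine ⟨⟨r, hr⟩, ?_⟩
  ext x y
  rw [starGraph_adj]
  constructor
  · intro h
    refine ⟨h.ne, ?_⟩
    by_contra hcon
    push Not at hcon
    have h1 : x.1 ≠ r := fun e => hcon.1 (Subtype.ext e)
    have h2 : y.1 ≠ r := fun e => hcon.2 (Subtype.ext e)
    exact h.ne (Subtype.ext (key r x.1 y.1 h1.symm h2.symm))
  · rintro ⟨hne, rfl | rfl⟩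
    · exact adj y.1 y.2 fun e => hne (Subtype.ext e)
    · exact (adj x.1 x.2 fun e => hne (Subtype.ext e.symm)).symm

theorem isStarChoosable_card [Finite V] (G : SimpleGraph V) : G.IsStarChoosable (Nat.card V) := by
  intro L hL
  have := Fintype.ofFinite V
  obtain ⟨f, hf, hfL⟩ := (Finset.all_card_le_biUnion_card_iff_exists_injective L).1 (by
    intro s
    obtain rfl | ⟨v, hv⟩ := s.eq_empty_or_nonempty
    · simp
    · calc s.card ≤ Nat.card V := by rw [Nat.card_eq_fintype_card]; exact s.card_le_univ
        _ ≤ (L v).card := hL v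
        _ ≤ (s.biUnion L).card := Finset.card_le_card (Finset.subset_biUnion_of_mem L hv))
  exact ⟨Coloring.mk f fun h e => h.ne (hf e), isStarColoring_of_injective _ hf, hfL⟩

theorem isStarChoosable_starChoiceNumber [Finite V] (G : SimpleGraph V) :
    G.IsStarChoosable G.starChoiceNumber :=
  Nat.sInf_mem (s := {k | G.IsStarChoosable k}) ⟨_, G.isStarChoosable_card⟩

theorem starChoiceNumber_le_iff [Finite V] {k : ℕ} :
    G.starChoiceNumber ≤ k ↔ G.IsStarChoosable k :=
  ⟨fun h => G.isStarChoosable_starChoiceNumber.mono h, fun h => Nat.sInf_le h⟩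

theorem hasArrangement_card [Finite V] (G : SimpleGraph V) : G.HasArrangement (Nat.card V) := by
  classical
  refine ⟨linearOrderOfSTO WellOrderingRel, fun v => ?_⟩
  refine (Set.encard_le_encard (Set.subset_univ _)).trans ?_
  rw [← Set.ncard_univ, Set.Finite.cast_ncard_eq Set.finite_univ]

theorem hasArrangement_arrangeability [Finite V] (G : SimpleGraph V) :
    G.HasArrangement G.arrangeability :=
  Nat.sInf_mem (s := {k | G.HasArrangement k}) ⟨_, G.hasArrangement_card⟩

theorem arrangeability_le_iff [Finite V] {k : ℕ} :
    G.arrangeability ≤ k ↔ G.HasArrangement k :=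
  ⟨fun h => G.hasArrangement_arrangeability.mono h, fun h => Nat.sInf_le h⟩

end Attained

end SimpleGraph

/-- A finite simple graph, bundled with its vertex set. -/
structure FiniteGraph where
  Vert : Type u
  finite : Finite Vert
  graph : SimpleGraph Vert

/-- A class of finite graphs has bounded star choice number. -/
def HasBoundedStarChoiceNumber (F : Set FiniteGraph.{u}) : Prop :=
  ∃ k : ℕ, ∀ G ∈ F, G.graph.starChoiceNumber ≤ k

/-- A class of finite graphs has bounded arrangeability. -/
def HasBoundedArrangeability (F : Set FiniteGraph.{u}) : Prop :=
  ∃ k : ℕ, ∀ G ∈ F, G.graph.arrangeability ≤ k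

/-! Small arrangeability bounds `starChoiceNumber` by greedy coloring along the ordering. Each
vertex avoids the colors of its smaller neighbors, of their smaller neighbors, and of the smaller
vertices sharing a later neighbor with it. A path `u, x, v` with equally colored ends then has `x`
before both ends, so a bicolored path on four vertices would need each of its two inner vertices to
precede the other.

Conversely, let `G` be star choosable from lists of size `s`, and build an ordering from its end,
with `S` the vertices still to be placed. Each step needs a vertex of `S` having few neighbors in
`S` and few vertices of `S` joined to it through a removed vertex. If none exists, half of `S`
violates one of the two conditions. The tool is `exists_lists_forcing_monochromatic`: a digraph in
which half of the vertices have large outdegree has lists of size `s` that force, in every list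
coloring, a vertex with more than `t` out-neighbors of its own color. For neighbors in `S` and `t =
0` this contradicts properness. For pairs joined through removed vertices and `t = D * s` it
contradicts the star property, since equally colored middle vertices at the same vertex must
coincide and each has at most `D` neighbors in `S`. -/

namespace SimpleGraph

/-! ### Star colorings as proper colorings without bicolored paths on four vertices. -/

section Star

variable {V : Type*} {G : SimpleGraph V}

/-- A graph without a walk `a, b, c, d` with `a ≠ c` and `b ≠ d` is a star forest. -/
theorem isStarForest_of_no_path
    (h : ∀ a b c d, G.Adj a b → G.Adj b c → G.Adj c d → a ≠ c → b ≠ d → False) :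
    G.IsStarForest := by
  intro C
  obtain ⟨r, hrC, hr⟩ : ∃ r ∈ C.supp, ∀ y z, y ∈ C.supp → G.Adj r y → G.Adj y z → z = r := by
    -- The centre is a vertex of degree at least two if there is one; otherwise any vertex will do.
    by_cases hx : ∃ x ∈ C.supp, ∃ y z, y ≠ z ∧ G.Adj x y ∧ G.Adj x z
    · obtain ⟨x, hxC, y, z, hyz, hxy, hxz⟩ := hx
      refine ⟨x, hxC, fun u w _ hu huw => ?_⟩
      by_contra hne
      by_cases hyu : y = u
      · exact h z x u w hxz.symm hu huw (fun e => hyz (hyu.trans e.symm)) (Ne.symm hne)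
      · exact h y x u w hxy.symm hu huw hyu (Ne.symm hne)
    · obtain ⟨r, hr⟩ := C.nonempty_supp
      refine ⟨r, hr, fun y z hy hry hyz => ?_⟩
      by_contra hne
      exact hx ⟨y, hy, z, r, hne, hyz, hry.symm⟩
  have near : ∀ y, G.Reachable r y → y = r ∨ G.Adj r y := by
    intro y hy
    rw [reachable_iff_reflTransGen] at hy
    induction hy with
    | refl => exact Or.inl rfl
    | @tail b c hb hbc ih =>
      rcases ih with rfl | ih
      · exact Or.inr hbc
      · refine Or.inl (hr b c ?_ ih hbc)
        rw [← hrC]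
        exact ConnectedComponent.sound ih.symm.reachable
  refine ⟨⟨r, hrC⟩, ?_⟩
  ext x y
  rw [starGraph_adj]
  have hx := near x.1 (ConnectedComponent.exact (hrC.trans x.2.symm))
  have hy := near y.1 (ConnectedComponent.exact (hrC.trans y.2.symm))
  constructor
  · intro hadj
    refine ⟨hadj.ne, ?_⟩
    rcases hx with hx | hx
    · exact Or.inl (Subtype.ext hx)
    · exact Or.inr (Subtype.ext (hr x.1 y.1 x.2 hx hadj))
  · rintro ⟨hne, rfl | rfl⟩
    · exact hy.resolve_left fun e => hne (Subtype.ext e.symm)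
    · exact (hx.resolve_left fun e => hne (Subtype.ext e)).symm

theorem isStarColoring_of_no_bicolored_path {α : Type*} (c : G.Coloring α)
    (h : ∀ x y z w, G.Adj x y → G.Adj y z → G.Adj z w → x ≠ z → y ≠ w → c x = c z →
      c y = c w → False) : IsStarColoring c := by
  intro a b _
  refine isStarForest_of_no_path fun x y z w hxy hyz hzw hxz hyw => ?_
  have h1 := c.valid (induce_adj.1 hxy)
  have h2 := c.valid (induce_adj.1 hyz)
  have h3 := c.valid (induce_adj.1 hzw)
  have hx : c x = a ∨ c x = b := x.2
  have hy : c y = a ∨ c y = b := y.2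
  have hz : c z = a ∨ c z = b := z.2
  have hw : c w = a ∨ c w = b := w.2
  exact h x y z w hxy hyz hzw (fun e => hxz (Subtype.ext e)) (fun e => hyw (Subtype.ext e))
    (by grind) (by grind)

theorem IsStarColoring.no_bicolored_path {α : Type*} {c : G.Coloring α} (hc : IsStarColoring c)
    {x y z w : V} (hxy : G.Adj x y) (hyz : G.Adj y z) (hzw : G.Adj z w) (hxz : x ≠ z)
    (hyw : y ≠ w) (h1 : c x = c z) (h2 : c y = c w) : False := by
  set s := c.colorClass (c x) ∪ c.colorClass (c y) with hs
  have hx : x ∈ s := Or.inl rfl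
  have hy : y ∈ s := Or.inr rfl
  have hz : z ∈ s := Or.inl h1.symm
  have hw : w ∈ s := Or.inr h2.symm
  let H := G.induce s
  have axy : H.Adj ⟨x, hx⟩ ⟨y, hy⟩ := hxy
  have ayz : H.Adj ⟨y, hy⟩ ⟨z, hz⟩ := hyz
  have azw : H.Adj ⟨z, hz⟩ ⟨w, hw⟩ := hzw
  let C := H.connectedComponentMk ⟨y, hy⟩
  obtain ⟨r, hr⟩ := hc (c x) (c y) (c.valid hxy) C
  -- No vertex lies on all three edges of the path, so none can be the centre.
  have star : ∀ (u v : s) (hu : u ∈ C.supp) (hv : v ∈ C.supp), H.Adj u v → r.1 = u ∨ r.1 = v := by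
    intro u v hu hv huv
    have : C.toSimpleGraph.Adj ⟨u, hu⟩ ⟨v, hv⟩ := huv
    rw [hr, starGraph_adj] at this
    rcases this.2 with e | e
    · exact Or.inl (congrArg Subtype.val e.symm)
    · exact Or.inr (congrArg Subtype.val e.symm)
  have cy : (⟨y, hy⟩ : s) ∈ C.supp := rfl
  have cx : (⟨x, hx⟩ : s) ∈ C.supp := ConnectedComponent.sound axy.reachable
  have cz : (⟨z, hz⟩ : s) ∈ C.supp := ConnectedComponent.sound ayz.symm.reachable
  have cw : (⟨w, hw⟩ : s) ∈ C.supp :=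
    ConnectedComponent.sound (ayz.reachable.trans azw.reachable).symm
  have e1 := star _ _ cx cy axy
  have e2 := star _ _ cy cz ayz
  have e3 := star _ _ cz cw azw
  have n1 := hxy.ne
  have n2 := hyz.ne
  have n3 := hzw.ne
  simp only [Subtype.ext_iff] at e1 e2 e3
  grind

end Star

/-! ### Greedy coloring along an arrangement. -/

section Greedy

variable {V : Type*}

/-- Greedy list coloring along a linear order, where `v` has to avoid the colors of `F v`. -/
theorem exists_greedy_coloring [Finite V] [LinearOrder V] (L : V → Finset ℕ) (F : V → Set V)
    (hF : ∀ v, (F v).encard < (L v).card) :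
    ∃ c : V → ℕ, (∀ v, c v ∈ L v) ∧ ∀ v, ∀ w ∈ F v, w < v → c v ≠ c w := by
  classical
  have avail : ∀ (v : V) (g : V → ℕ), ∃ x ∈ L v, ∀ w ∈ F v, x ≠ g w := by
    intro v g
    by_contra! hcon
    have hsub : ((L v : Finset ℕ) : Set ℕ) ⊆ g '' F v := by
      intro x hx
      obtain ⟨w, hw, e⟩ := hcon x hx
      exact ⟨w, hw, e.symm⟩
    have h1 := Set.encard_le_encard hsub
    rw [Set.encard_coe_eq_coe_finsetCard] at h1
    exact absurd (h1.trans (Set.encard_image_le g _)) (not_le.2 (hF v))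
  choose pick hpL hpF using avail
  have wf : WellFounded ((· < ·) : V → V → Prop) := wellFounded_lt
  let step : ∀ v : V, (∀ w, w < v → ℕ) → ℕ :=
    fun v ih => pick v fun w => if h : w < v then ih w h else 0
  have hfix : ∀ v, wf.fix step v = pick v fun w => if w < v then wf.fix step w else 0 := by
    intro v
    rw [WellFounded.fix_eq]
    simp only [step, dite_eq_ite]
  refine ⟨wf.fix step, fun v => ?_, fun v w hw hlt => ?_⟩
  · rw [hfix]
    exact hpL _ _
  · have := hpF v (fun w => if w < v then wf.fix step w else 0) w hw
    rw [← hfix] at this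
    simpa [hlt] using this

variable {G : SimpleGraph V} {k : ℕ}

/-- In an arrangement, every vertex has at most `k + 1` smaller neighbors. -/
theorem encard_back_neighbors_le [Finite V] [LinearOrder V]
    (h : ∀ v : V, {w | w < v ∧ ∃ x, v < x ∧ G.Adj w x ∧ G.Adj v x}.encard ≤ k) (v : V) :
    {w | w < v ∧ G.Adj w v}.encard ≤ k + 1 := by
  rcases Set.eq_empty_or_nonempty {w | w < v ∧ G.Adj w v} with he | hne
  · rw [he]; simp
  -- All smaller neighbors of `v` other than the largest one, `m`, precede `m` and share the later
  -- neighbor `v` with it.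
  obtain ⟨m, hm, hmax⟩ := (Set.toFinite {w | w < v ∧ G.Adj w v}).exists_maximal hne
  have hsub : {w | w < v ∧ G.Adj w v} ⊆
      insert m {w | w < m ∧ ∃ x, m < x ∧ G.Adj w x ∧ G.Adj m x} := by
    intro w hw
    rcases lt_trichotomy w m with hlt | rfl | hgt
    · exact Or.inr ⟨hlt, v, hm.1, hw.2, hm.2⟩
    · exact Or.inl rfl
    · exact absurd (hmax hw hgt.le) (not_le.2 hgt)
  exact (Set.encard_le_encard hsub).trans ((Set.encard_insert_le _ _).trans (by gcongr; exact h m))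

theorem HasArrangement.isStarChoosable [Finite V] (h : G.HasArrangement k) :
    G.IsStarChoosable ((k + 2) ^ 2) := by
  classical
  obtain ⟨o, ho⟩ := h
  have := Fintype.ofFinite V
  have hb := encard_back_neighbors_le ho
  intro L hL
  let F1 : V → Set V := fun v => {w | w < v ∧ G.Adj w v}
  let F2 : V → Set V := fun v => {w | w < v ∧ ∃ x, v < x ∧ G.Adj w x ∧ G.Adj v x}
  let F3 : V → Set V := fun v => ⋃ x ∈ F1 v, F1 x
  have hcard3 : ∀ v, (F3 v).encard ≤ ((k + 1) * (k + 1) : ℕ) := by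
    intro v
    have hfin : ∀ x, (F1 x).toFinset.card ≤ k + 1 := by
      intro x
      have := hb x
      rw [← Set.coe_toFinset {w | w < x ∧ G.Adj w x}, Set.encard_coe_eq_coe_finsetCard] at this
      exact_mod_cast this
    have heq : F3 v = (((F1 v).toFinset.biUnion fun x => (F1 x).toFinset : Finset V) : Set V) := by
      ext w; simp [F3]
    rw [heq, Set.encard_coe_eq_coe_finsetCard]
    exact_mod_cast (Finset.card_biUnion_le_card_mul _ _ _ fun x _ => hfin x).trans
      (Nat.mul_le_mul_right _ (hfin v))
  -- At most `(k + 1) + k + (k + 1) ^ 2 = (k + 2) ^ 2 - 2` vertices have to be avoided.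
  obtain ⟨c, hcL, hc⟩ := exists_greedy_coloring L (fun v => F1 v ∪ F2 v ∪ F3 v) (by
    intro v
    calc (F1 v ∪ F2 v ∪ F3 v).encard ≤ (F1 v).encard + (F2 v).encard + (F3 v).encard :=
          (Set.encard_union_le _ _).trans (by gcongr; exact Set.encard_union_le _ _)
      _ ≤ (k + 1) + k + ((k + 1) * (k + 1) : ℕ) := by
          gcongr
          exacts [hb v, ho v, hcard3 v]
      _ < (((k + 2) ^ 2 : ℕ) : ℕ∞) := by
          have : (k + 1) + k + (k + 1) * (k + 1) < (k + 2) ^ 2 := by nlinarith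
          exact_mod_cast this
      _ ≤ (L v).card := by exact_mod_cast hL v)
  have proper : ∀ {v w}, G.Adj v w → c v ≠ c w := by
    intro v w hvw
    rcases lt_or_gt_of_ne hvw.ne with hlt | hlt
    · exact (hc w v (Or.inl (Or.inl ⟨hlt, hvw⟩)) hlt).symm
    · exact hc v w (Or.inl (Or.inl ⟨hlt, hvw.symm⟩)) hlt
  -- With `u < x`, the vertex `u` lies in `F3 v` if `x < v` and in `F2 v` if `v < x`.
  have middle : ∀ u x v, G.Adj u x → G.Adj x v → u < v → c u = c v → x < u := by
    intro u x v hux hxv huv e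
    by_contra hcon
    have hlt : u < x := lt_of_le_of_ne (not_lt.1 hcon) hux.ne
    rcases lt_or_gt_of_ne hxv.ne with h1 | h1
    · refine hc v u (Or.inr ?_) huv e.symm
      exact Set.mem_biUnion (show x ∈ F1 v from ⟨h1, hxv⟩) ⟨hlt, hux⟩
    · exact hc v u (Or.inl (Or.inr ⟨huv, x, h1, hux, hxv.symm⟩)) huv e.symm
  have middle' : ∀ u x v, G.Adj u x → G.Adj x v → u ≠ v → c u = c v → x < u ∧ x < v := by
    intro u x v hux hxv hne e
    rcases lt_or_gt_of_ne hne with h1 | h1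
    · have := middle u x v hux hxv h1 e
      exact ⟨this, this.trans h1⟩
    · have := middle v x u hxv.symm hux.symm h1 e.symm
      exact ⟨this.trans h1, this⟩
  refine ⟨Coloring.mk c proper, isStarColoring_of_no_bicolored_path _ ?_, hcL⟩
  intro x y z w hxy hyz hzw hxz hyw e1 e2
  exact lt_asymm (middle' x y z hxy hyz hxz e1).2 (middle' y z w hyz hzw hyw e2).1

end Greedy

/-! ### Lists that force many neighbors of one's own color. -/

section Lists

open Finset

theorem card_functions_avoiding {V Λ : Type*} [Fintype V] [DecidableEq V] [Fintype Λ]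
    [DecidableEq Λ] (W : Finset V) (l : Λ) :
    #{f : V → Λ | ∀ w ∈ W, f w ≠ l} * Fintype.card Λ ^ #W =
      (Fintype.card Λ - 1) ^ #W * Fintype.card Λ ^ Fintype.card V := by
  have h : ({f : V → Λ | ∀ w ∈ W, f w ≠ l} : Finset (V → Λ)) =
      Fintype.piFinset fun v => if v ∈ W then univ.erase l else univ := by
    ext f
    simp only [mem_filter_univ, Fintype.mem_piFinset]
    refine forall_congr' fun v => ?_
    split_ifs with hv <;> simp [hv]
  have hc : ∀ v, #(if v ∈ W then univ.erase l else univ : Finset Λ) =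
      if v ∈ W then Fintype.card Λ - 1 else Fintype.card Λ := by
    intro v
    split_ifs <;> simp [card_erase_of_mem]
  rw [h, Fintype.card_piFinset, prod_congr rfl fun v _ => hc v, prod_ite, prod_const, prod_const]
  have h1 : ({v | v ∈ W} : Finset V) = W := by ext; simp
  have h2 : #({v | v ∉ W} : Finset V) + #W = Fintype.card V := by
    have := card_filter_add_card_filter_not (s := (univ : Finset V)) (· ∈ W)
    rw [h1] at this
    rw [← card_univ]
    omega
  rw [h1, mul_assoc, ← pow_add, h2]

/-- If `d` is large in terms of the number of labels, then a random labelling shows all labels in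
most of the given sets of size at least `d`. -/
theorem exists_labelling {V Λ : Type*} [Fintype V] [DecidableEq V] [Fintype Λ] [DecidableEq Λ]
    [Nonempty Λ] {d : ℕ}
    (hd : 8 * Fintype.card Λ * (Fintype.card Λ - 1) ^ d ≤ Fintype.card Λ ^ d)
    (N : V → Finset V) (P : Finset V) (hN : ∀ v ∈ P, d ≤ #(N v)) :
    ∃ f : V → Λ, 8 * #{v ∈ P | ∃ l, ∀ w ∈ N v, f w ≠ l} ≤ Fintype.card V := by
  set q := Fintype.card Λ with hq
  have hq0 : 0 < q := Fintype.card_pos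
  have one : ∀ v ∈ P, ∀ l : Λ, 8 * q * #{f : V → Λ | ∀ w ∈ N v, f w ≠ l} ≤ q ^ Fintype.card V := by
    intro v hv l
    obtain ⟨W, hWN, hWd⟩ := exists_subset_card_eq (hN v hv)
    have hle : #{f : V → Λ | ∀ w ∈ N v, f w ≠ l} ≤ #{f : V → Λ | ∀ w ∈ W, f w ≠ l} :=
      card_le_card (monotone_filter_right _ fun f _ hf w hw => hf w (hWN hw))
    have hcount := card_functions_avoiding W l
    rw [hWd, ← hq] at hcount
    refine Nat.le_of_mul_le_mul_right ?_ (pow_pos hq0 d)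
    calc 8 * q * #{f : V → Λ | ∀ w ∈ N v, f w ≠ l} * q ^ d
        ≤ 8 * q * (#{f : V → Λ | ∀ w ∈ W, f w ≠ l} * q ^ d) := by
          rw [mul_assoc (8 * q)]; gcongr
      _ = 8 * q * (q - 1) ^ d * q ^ Fintype.card V := by rw [hcount]; ring
      _ ≤ q ^ Fintype.card V * q ^ d := by rw [mul_comm]; gcongr
  have two : ∀ v ∈ P, 8 * #{f : V → Λ | ∃ l, ∀ w ∈ N v, f w ≠ l} ≤ q ^ Fintype.card V := by
    intro v hv
    have hsub : ({f : V → Λ | ∃ l, ∀ w ∈ N v, f w ≠ l} : Finset (V → Λ)) ⊆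
        univ.biUnion fun l => {f : V → Λ | ∀ w ∈ N v, f w ≠ l} := by
      intro f hf
      simpa using hf
    refine Nat.le_of_mul_le_mul_left ?_ hq0
    calc q * (8 * #{f : V → Λ | ∃ l, ∀ w ∈ N v, f w ≠ l})
        ≤ q * (8 * ∑ l, #{f : V → Λ | ∀ w ∈ N v, f w ≠ l}) := by
          gcongr; exact (card_le_card hsub).trans card_biUnion_le
      _ = ∑ l, 8 * q * #{f : V → Λ | ∀ w ∈ N v, f w ≠ l} := by rw [← mul_sum]; ring
      _ ≤ ∑ _l : Λ, q ^ Fintype.card V := sum_le_sum fun l _ => one v hv l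
      _ = q * q ^ Fintype.card V := by simp [hq]
  -- Double counting of pairs of a labelling and a vertex missing a label: an average labelling is
  -- good enough.
  by_contra! hcon
  have swap : ∑ f : V → Λ, #{v ∈ P | ∃ l, ∀ w ∈ N v, f w ≠ l} =
      ∑ v ∈ P, #{f : V → Λ | ∃ l, ∀ w ∈ N v, f w ≠ l} := by
    simp only [card_filter]
    exact sum_comm
  have lower : q ^ Fintype.card V * Fintype.card V <
      8 * ∑ f : V → Λ, #{v ∈ P | ∃ l, ∀ w ∈ N v, f w ≠ l} := by
    rw [mul_sum]
    calc q ^ Fintype.card V * Fintype.card V = ∑ _f : V → Λ, Fintype.card V := by simp [hq]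
      _ < _ := sum_lt_sum_of_nonempty univ_nonempty fun f _ => hcon f
  rw [swap, mul_sum] at lower
  have upper := sum_le_card_nsmul P _ _ two
  rw [smul_eq_mul] at upper
  have : #P * q ^ Fintype.card V ≤ q ^ Fintype.card V * Fintype.card V := by
    rw [mul_comm]; gcongr; exact card_le_univ P
  omega

/-- If every list is a frequently occurring list of a neighbor in `B`, then at least `s` colors
occur often among the neighbors in `B`. -/
theorem exists_frequent_list {V : Type*} [DecidableEq V] {s t : ℕ} (X : Finset V)
    (L : V → Finset ℕ) (c : V → ℕ) (hc : ∀ w ∈ X, c w ∈ L w)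
    (hX : ∀ τ ∈ powersetCard s (range (2 * s)), s * t < #{w ∈ X | L w = τ}) :
    ∃ τ ∈ powersetCard s (range (2 * s)), ∀ x ∈ τ, t < #{w ∈ X | c w = x} := by
  set F := {x ∈ range (2 * s) | t < #{w ∈ X | c w = x}} with hF
  have hlt : #(range (2 * s) \ F) < s := by
    -- Otherwise `s` rare colors form a list `τ`. More than `s * t` vertices of `X` have this list,
    -- so one of its colors is used more than `t` times.
    by_contra! hge
    obtain ⟨τ, hτ, hτs⟩ := exists_subset_card_eq hge
    have hmem : τ ∈ powersetCard s (range (2 * s)) :=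
      mem_powersetCard.2 ⟨hτ.trans sdiff_subset, hτs⟩
    have hbig := hX τ hmem
    rw [← hτs] at hbig
    obtain ⟨x, hx, hxt⟩ := exists_lt_card_fiber_of_mul_lt_card_of_maps_to (f := c)
      (fun w hw => by
        obtain ⟨hwX, hwτ⟩ := mem_filter.1 hw
        exact hwτ ▸ hc w hwX) hbig
    have hxF := mem_sdiff.1 (hτ hx)
    refine hxF.2 (mem_filter.2 ⟨hxF.1, hxt.trans_le (card_le_card ?_)⟩)
    exact filter_subset_filter _ (filter_subset _ _)
  have hFs : s ≤ #F := by
    have := card_sdiff_add_card_eq_card (filter_subset _ _ : F ⊆ range (2 * s))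
    rw [← hF, card_range] at this
    omega
  obtain ⟨τ, hτ, hτs⟩ := exists_subset_card_eq hFs
  exact ⟨τ, mem_powersetCard.2 ⟨hτ.trans (filter_subset _ _), hτs⟩,
    fun x hx => (mem_filter.1 (hτ hx)).2⟩

/-- Lists on a small set `B` extend to lists on a large set `A` such that no list coloring is
almost proper between `A` and `B`. -/
theorem exists_lists_of_bipartite {V : Type*} [Fintype V] [DecidableEq V] {s t : ℕ}
    (A B : Finset V) (hAB : Disjoint A B) (L : V → Finset ℕ)
    (hL : ∀ v, L v ∈ powersetCard s (range (2 * s))) (N : V → Finset V)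
    (hN : ∀ a ∈ A, ∀ τ ∈ powersetCard s (range (2 * s)), s * t < #{w ∈ N a ∩ B | L w = τ})
    (hcard : s ^ #B * (#(powersetCard s (range (2 * s))) - 1) ^ #A <
      #(powersetCard s (range (2 * s))) ^ #A) :
    ∃ L' : V → Finset ℕ, (∀ v, L' v ∈ powersetCard s (range (2 * s))) ∧
      ∀ c : V → ℕ, (∀ v, c v ∈ L' v) → ∃ v ∈ A, t < #{w ∈ N v | c w = c v} := by
  set T := powersetCard s (range (2 * s)) with hT
  let ext : (∀ a ∈ A, Finset ℕ) → V → Finset ℕ := fun g v => if h : v ∈ A then g v h else L v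
  by_contra! hcon
  have hext : ∀ g ∈ A.pi fun _ => T, ∀ v, ext g v ∈ T := by
    intro g hg v
    simp only [ext]
    split_ifs with h
    · exact mem_pi.1 hg v h
    · exact hL v
  have hcol : ∀ g, ∃ c : V → ℕ, g ∈ A.pi (fun _ => T) →
      (∀ v, c v ∈ ext g v) ∧ ∀ v ∈ A, #{w ∈ N v | c w = c v} ≤ t := by
    intro g
    by_cases hg : g ∈ A.pi fun _ => T
    · obtain ⟨c, h1, h2⟩ := hcon (ext g) (hext g hg)
      exact ⟨c, fun _ => ⟨h1, h2⟩⟩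
    · exact ⟨0, fun h => absurd h hg⟩
  choose col hcol using hcol
  have hextB : ∀ g, ∀ b ∈ B, ext g b = L b := by
    intro g b hb
    exact dif_neg fun h => Finset.disjoint_left.1 hAB h hb
  have maps : ∀ g ∈ A.pi (fun _ => T), (fun b (_ : b ∈ B) => col g b) ∈ B.pi L := by
    intro g hg
    rw [mem_pi]
    intro b hb
    have := (hcol g hg).1 b
    rwa [hextB g b hb] at this
  have fibre : ∀ φ ∈ B.pi L, #{g ∈ A.pi (fun _ => T) | (fun b (_ : b ∈ B) => col g b) = φ} ≤
      (#T - 1) ^ #A := by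
    -- Once the coloring `φ` of `B` is fixed, each `a ∈ A` has a list `τ a` all of whose colors are
    -- frequent among its neighbors in `B`. An assignment on `A` whose chosen coloring restricts to
    -- `φ` must avoid `τ a` at every `a`.
    intro φ hφ
    let c₀ : V → ℕ := fun v => if h : v ∈ B then φ v h else 0
    have hc₀ : ∀ v ∈ B, c₀ v ∈ L v := by
      intro v hv
      simp only [c₀, dif_pos hv]
      exact mem_pi.1 hφ v hv
    have key : ∀ a, ∃ τ ∈ T, a ∈ A → ∀ x ∈ τ, t < #{w ∈ N a ∩ B | c₀ w = x} := by
      intro a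
      by_cases ha : a ∈ A
      · obtain ⟨τ, hτ, h⟩ := exists_frequent_list (N a ∩ B) L c₀
          (fun w hw => hc₀ w (mem_inter.1 hw).2) (hN a ha)
        exact ⟨τ, hτ, fun _ => h⟩
      · exact ⟨L a, hL a, fun h => absurd h ha⟩
    choose τ hτT hτ using key
    have hsub : {g ∈ A.pi (fun _ => T) | (fun b (_ : b ∈ B) => col g b) = φ} ⊆
        A.pi fun a => T.erase (τ a) := by
      intro g hg
      obtain ⟨hg, hgφ⟩ := mem_filter.1 hg
      rw [mem_pi]
      intro a ha
      refine mem_erase.2 ⟨fun e => ?_, mem_pi.1 hg a ha⟩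
      have h1 := (hcol g hg).1 a
      simp only [ext, dif_pos ha, e] at h1
      have h2 := hτ a ha _ h1
      refine absurd ((hcol g hg).2 a ha) (not_le.2 (h2.trans_le (card_le_card ?_)))
      intro w hw
      obtain ⟨hw, hwc⟩ := mem_filter.1 hw
      obtain ⟨hwN, hwB⟩ := mem_inter.1 hw
      refine mem_filter.2 ⟨hwN, ?_⟩
      rw [← hwc]
      simp [hwB, c₀, ← hgφ]
    refine (card_le_card hsub).trans ?_
    rw [card_pi, prod_congr rfl fun a _ => card_erase_of_mem (hτT a), prod_const]
  -- There are only `s ^ #B` colorings of `B`, too few to serve all `#T ^ #A` assignments on `A`.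
  have total := card_le_mul_card_image_of_maps_to maps _ fibre
  rw [card_pi, card_pi, prod_const, prod_congr rfl fun b _ => (mem_powersetCard.1 (hL b)).2,
    prod_const, mul_comm] at total
  omega

/-- If half of the vertices have many neighbors, then there are lists of size `s` such that in
every list coloring some of these vertices has more than `t` neighbors of its own color. -/
theorem exists_lists_forcing_monochromatic {s : ℕ} (hs : 0 < s) (t : ℕ) :
    ∃ d : ℕ, ∀ {V : Type u} [Fintype V] [DecidableEq V] [Nonempty V] (N : V → Finset V)
      (P : Finset V), Fintype.card V ≤ 2 * #P → (∀ v ∈ P, d ≤ #(N v)) →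
      ∃ L : V → Finset ℕ, (∀ v, #(L v) = s) ∧
        ∀ c : V → ℕ, (∀ v, c v ∈ L v) → ∃ v ∈ P, t < #{w ∈ N v | c w = c v} := by
  set T := powersetCard s (range (2 * s)) with hT
  have hTpos : 0 < #T := by
    rw [hT, card_powersetCard, card_range]
    exact Nat.choose_pos (by omega)
  have grow : ∀ K q : ℕ, 0 < q → ∃ M₀, ∀ M ≥ M₀, K * (q - 1) ^ M < q ^ M := by
    intro K q hq
    have hq' : (0 : ℝ) < q := by exact_mod_cast hq
    have hlim : Filter.Tendsto (fun M : ℕ => (K : ℝ) * (((q - 1 : ℕ) : ℝ) / q) ^ M) Filter.atTop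
        (nhds (K * 0)) := by
      refine (tendsto_pow_atTop_nhds_zero_of_lt_one (by positivity) ?_).const_mul _
      rw [div_lt_one hq']
      exact_mod_cast Nat.sub_lt hq one_pos
    rw [mul_zero] at hlim
    obtain ⟨M₀, h⟩ := Filter.eventually_atTop.1 (hlim.eventually (gt_mem_nhds one_pos))
    refine ⟨M₀, fun M hM => ?_⟩
    have := h M hM
    rw [div_pow, ← mul_div_assoc, div_lt_one (by positivity)] at this
    exact_mod_cast this
  obtain ⟨M₀, hM₀⟩ := grow (s ^ 4) #T hTpos
  obtain ⟨M, hM8, hM⟩ : ∃ M, 8 ≤ M ∧ s ^ 4 * (#T - 1) ^ M < #T ^ M :=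
    ⟨max 8 M₀, le_max_left _ _, hM₀ _ (le_max_right _ _)⟩
  have : NeZero M := ⟨by omega⟩
  have : Nonempty T := (card_pos.1 hTpos).to_subtype
  -- The first coordinate yields a sparse set `B` as its rarest class, the third is the list of a
  -- vertex of `B`, and the second supplies `s * t + 1` distinct neighbors with each list.
  let Λ := Fin M × Fin (s * t + 1) × T
  obtain ⟨d, hd⟩ := grow (8 * Fintype.card Λ) (Fintype.card Λ) Fintype.card_pos
  refine ⟨d, fun {V} _ _ _ N P hP hN => ?_⟩
  obtain ⟨f, hf⟩ := exists_labelling (Λ := Λ) (hd d le_rfl).le N P hN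
  set bad := {v ∈ P | ∃ l, ∀ w ∈ N v, f w ≠ l} with hbad
  obtain ⟨i, hi⟩ : ∃ i : Fin M, M * #{v | (f v).1 = i} ≤ Fintype.card V := by
    by_contra! hcon
    have h1 : ∑ i : Fin M, Fintype.card V < ∑ i : Fin M, M * #{v | (f v).1 = i} :=
      sum_lt_sum_of_nonempty univ_nonempty fun i _ => hcon i
    rw [← mul_sum, ← card_eq_sum_card_fiberwise (by simp)] at h1
    simp at h1
  set B : Finset V := {v | (f v).1 = i} with hB
  set A := (P \ bad) \ B with hA
  -- Half of the vertices lie in `P`; at most an eighth are bad and, as `8 ≤ M`, at most an eighth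
  -- lie in `B`.
  have hAcard : Fintype.card V ≤ 4 * #A := by
    have h1 := le_card_sdiff B (P \ bad)
    have h2 := le_card_sdiff bad P
    have h3 : 8 * #B ≤ M * #B := Nat.mul_le_mul_right _ hM8
    rw [← hA] at h1
    omega
  have hApos : 0 < #A := by
    have := Fintype.card_pos (α := V)
    omega
  obtain ⟨L, hL, hLc⟩ := exists_lists_of_bipartite (s := s) (t := t) A B sdiff_disjoint
    (fun v => (f v).2.2) (fun v => (f v).2.2.2) N (by
      intro a ha τ hτ
      have ha' : ∀ l, ∃ w ∈ N a, f w = l := by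
        have h1 := (mem_sdiff.1 (mem_sdiff.1 ha).1)
        have h2 := h1.2
        rw [hbad, mem_filter] at h2
        push Not at h2
        exact h2 h1.1
      choose w hwN hw using fun j : Fin (s * t + 1) => ha' (i, j, ⟨τ, hτ⟩)
      have hinj : Function.Injective w := by
        intro j j' e
        have := (hw j).symm.trans ((congrArg f e).trans (hw j'))
        exact (Prod.mk.inj (Prod.mk.inj this).2).1
      calc s * t < #(univ.image w) := by rw [card_image_of_injective _ hinj]; simp
        _ ≤ _ := card_le_card fun v hv => by
          obtain ⟨j, -, rfl⟩ := mem_image.1 hv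
          simp [hwN, hw, hB]) (by
      -- The `M`-th power turns the exponent of `s` into `M * #B`, which is at most `4 * #A`.
      refine lt_of_pow_lt_pow_left₀ M (by positivity) ?_
      calc (s ^ #B * (#T - 1) ^ #A) ^ M = s ^ (M * #B) * (#T - 1) ^ (#A * M) := by
            rw [mul_pow, ← pow_mul, ← pow_mul, mul_comm #B]
        _ ≤ s ^ (4 * #A) * (#T - 1) ^ (#A * M) := by
            refine Nat.mul_le_mul_right _ (Nat.pow_le_pow_right hs ?_)
            exact hi.trans hAcard
        _ = (s ^ 4 * (#T - 1) ^ M) ^ #A := by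
            rw [mul_pow, ← pow_mul, ← pow_mul, mul_comm M]
        _ < (#T ^ M) ^ #A := Nat.pow_lt_pow_left hM hApos.ne'
        _ = (#T ^ #A) ^ M := by rw [← pow_mul, ← pow_mul, mul_comm])
  exact ⟨L, fun v => (mem_powersetCard.1 (hL v)).2, fun c hc => by
    obtain ⟨v, hv, h⟩ := hLc c hc
    exact ⟨v, (mem_sdiff.1 (mem_sdiff.1 hv).1).1, h⟩⟩

end Lists

/-! ### From bounded star choice number to an arrangement. -/

section Ordering

open Finset

variable {V : Type u} {G : SimpleGraph V}

/-- Vertices are removed from the end of the ordering one by one. -/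
theorem exists_enumeration [DecidableEq V] {D k : ℕ}
    (h : ∀ S : Finset V, S.Nonempty → (∀ x ∉ S, {w | w ∈ S ∧ G.Adj w x}.encard ≤ D) →
      ∃ v ∈ S, {w | w ∈ S ∧ G.Adj w v}.encard ≤ D ∧
        {w | w ∈ S ∧ w ≠ v ∧ ∃ x ∉ S, G.Adj w x ∧ G.Adj v x}.encard ≤ k) (S : Finset V)
    (hS : ∀ x ∉ S, {w | w ∈ S ∧ G.Adj w x}.encard ≤ D) :
    ∃ e : V → ℕ, Set.InjOn e S ∧ ∀ v ∈ S,
      {w | w ∈ S ∧ e w < e v ∧ ∃ x, (x ∉ S ∨ e v < e x) ∧ G.Adj w x ∧ G.Adj v x}.encard ≤ k := by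
  induction S using Finset.strongInduction with
  | H S ih =>
    rcases S.eq_empty_or_nonempty with rfl | hne
    · exact ⟨fun _ => 0, by simp, by simp⟩
    obtain ⟨v, hv, hvD, hvk⟩ := h S hne hS
    obtain ⟨e, he, hek⟩ := ih (S.erase v) (erase_ssubset hv) (by
      intro x hx
      have hle : {w | w ∈ S.erase v ∧ G.Adj w x} ⊆ {w | w ∈ S ∧ G.Adj w x} :=
        fun w hw => ⟨mem_of_mem_erase hw.1, hw.2⟩
      refine (Set.encard_le_encard hle).trans ?_
      by_cases hxv : x = v
      · exact hxv ▸ hvD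
      · exact hS x fun hxS => hx (mem_erase.2 ⟨hxv, hxS⟩))
    have hlt : ∀ w ∈ S, w ≠ v → e w < S.sup e + 1 := fun w hw _ =>
      Nat.lt_succ_of_le (le_sup hw)
    -- The removed vertex comes last within `S`. Values of `e` outside `S` are meaningless, as those
    -- vertices count as later anyway.
    refine ⟨Function.update e v (S.sup e + 1), ?_, ?_⟩
    · intro a ha b hb hab
      have ha' := hlt a ha
      have hb' := hlt b hb
      by_cases h1 : a = v <;> by_cases h2 : b = v
      · exact h1.trans h2.symm
      · subst h1
        simp only [Function.update_self, Function.update_of_ne h2] at hab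
        exact absurd hab (hb' h2).ne'
      · subst h2
        simp only [Function.update_self, Function.update_of_ne h1] at hab
        exact absurd hab (ha' h1).ne
      · simp only [Function.update_of_ne h1, Function.update_of_ne h2] at hab
        exact he (mem_erase.2 ⟨h1, ha⟩) (mem_erase.2 ⟨h2, hb⟩) hab
    · intro u hu
      by_cases huv : u = v
      · subst huv
        refine (Set.encard_le_encard ?_).trans hvk
        rintro w ⟨hw, hwu, x, hx, hadj⟩
        have hwne : w ≠ u := by rintro rfl; exact hwu.ne rfl
        refine ⟨hw, hwne, x, fun hxS => ?_, hadj⟩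
        have hxu := hx.resolve_left (not_not.2 hxS)
        by_cases h1 : x = u
        · exact (h1 ▸ hxu).ne rfl
        · simp only [Function.update_self, Function.update_of_ne h1] at hxu
          exact lt_asymm hxu (hlt x hxS h1)
      · refine (Set.encard_le_encard ?_).trans (hek u (mem_erase.2 ⟨huv, hu⟩))
        rintro w ⟨hw, hwu, x, hx, hadj⟩
        have hwv : w ≠ v := by
          rintro rfl
          simp only [Function.update_self, Function.update_of_ne huv] at hwu
          exact lt_asymm hwu (hlt u hu huv)
        simp only [Function.update_of_ne huv, Function.update_of_ne hwv] at hwu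
        refine ⟨mem_erase.2 ⟨hwv, hw⟩, hwu, x, ?_, hadj⟩
        by_cases h1 : x = v
        · exact Or.inl (h1 ▸ notMem_erase v S)
        · rw [Function.update_of_ne huv, Function.update_of_ne h1] at hx
          exact hx.imp_left fun hxS hxe => hxS (mem_of_mem_erase hxe)

theorem hasArrangement_of_forall_finset [Finite V] {D k : ℕ}
    (h : ∀ S : Finset V, S.Nonempty → (∀ x ∉ S, {w | w ∈ S ∧ G.Adj w x}.encard ≤ D) →
      ∃ v ∈ S, {w | w ∈ S ∧ G.Adj w v}.encard ≤ D ∧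
        {w | w ∈ S ∧ w ≠ v ∧ ∃ x ∉ S, G.Adj w x ∧ G.Adj v x}.encard ≤ k) :
    G.HasArrangement k := by
  classical
  have := Fintype.ofFinite V
  obtain ⟨e, he, hk⟩ := exists_enumeration h univ (by simp)
  rw [coe_univ, Set.injOn_univ] at he
  refine ⟨LinearOrder.lift' e he, fun v => (Set.encard_le_encard ?_).trans (hk v (mem_univ v))⟩
  rintro w ⟨hwv, x, hvx, hadj⟩
  exact ⟨mem_univ w, hwv, x, Or.inr hvx, hadj⟩

/-- Giving all vertices outside `S` the same list leaves them only `s` colors, which later bounds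
the number of differently colored middle vertices. -/
theorem exists_lists_forcing_monochromatic_on {s : ℕ} (hs : 0 < s) (t : ℕ) :
    ∃ d : ℕ, ∀ {V : Type u} [DecidableEq V] (S P : Finset V) (N : V → Finset V), S.Nonempty →
      P ⊆ S → #S ≤ 2 * #P → (∀ v ∈ P, N v ⊆ S) → (∀ v ∈ P, d ≤ #(N v)) →
      ∃ L : V → Finset ℕ, (∀ v, #(L v) = s) ∧ (∀ v ∉ S, L v = range s) ∧
        ∀ c : V → ℕ, (∀ v, c v ∈ L v) → ∃ v ∈ P, t < #{w ∈ N v | c w = c v} := by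
  obtain ⟨d, hd⟩ := exists_lists_forcing_monochromatic.{u} hs t
  refine ⟨d, fun {V} _ S P N hS hPS hP hNS hN => ?_⟩
  have : Nonempty S := hS.to_subtype
  have hcard : ∀ X ⊆ S, #(X.subtype (· ∈ S)) = #X := fun X hX => by
    rw [card_subtype, filter_true_of_mem fun x hx => hX hx]
  obtain ⟨L, hL, hc⟩ := hd (fun v : S => (N v).subtype (· ∈ S)) (P.subtype (· ∈ S))
    (by rwa [hcard P hPS, Fintype.card_coe])
    (fun v hv => by
      have hvP : v.1 ∈ P := mem_subtype.1 hv
      rw [hcard _ (hNS v.1 hvP)]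
      exact hN v.1 hvP)
  refine ⟨fun v => if h : v ∈ S then L ⟨v, h⟩ else range s, fun v => ?_, fun v hv => dif_neg hv,
    fun c hcL => ?_⟩
  · dsimp only
    split_ifs
    · exact hL _
    · exact card_range s
  · obtain ⟨v, hv, ht⟩ := hc (fun v => c v) (fun v => by simpa using hcL v)
    refine ⟨v, mem_subtype.1 hv, ht.trans_le ?_⟩
    refine card_le_card_of_injOn Subtype.val (fun w hw => ?_) Subtype.val_injective.injOn
    simpa using hw

theorem exists_hasArrangement_of_isStarChoosable {s : ℕ} (hs : 0 < s) :
    ∃ k : ℕ, ∀ {V : Type u} [Finite V] (G : SimpleGraph V), G.IsStarChoosable s →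
      G.HasArrangement k := by
  classical
  obtain ⟨D, hD⟩ := exists_lists_forcing_monochromatic_on.{u} hs 0
  obtain ⟨k, hk⟩ := exists_lists_forcing_monochromatic_on.{u} hs (D * s)
  refine ⟨k, fun {V} _ G hG => hasArrangement_of_forall_finset (D := D) fun S hS hSD => ?_⟩
  have := Fintype.ofFinite V
  by_contra! hstuck
  let N₁ : V → Finset V := fun v => {w ∈ S | G.Adj w v}
  let N₂ : V → Finset V := fun v => {w ∈ S | w ≠ v ∧ ∃ x ∉ S, G.Adj w x ∧ G.Adj v x}
  have hN₁ : ∀ v, {w | w ∈ S ∧ G.Adj w v}.encard = #(N₁ v) := fun v => by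
    rw [← Set.encard_coe_eq_coe_finsetCard]; simp [N₁]
  have hN₂ : ∀ v, {w | w ∈ S ∧ w ≠ v ∧ ∃ x ∉ S, G.Adj w x ∧ G.Adj v x}.encard = #(N₂ v) :=
    fun v => by rw [← Set.encard_coe_eq_coe_finsetCard]; simp [N₂]
  simp only [hN₁, hN₂, Nat.cast_le, Nat.cast_lt] at hSD hstuck
  let P₁ := {v ∈ S | D < #(N₁ v)}
  let P₂ := {v ∈ S | ¬ D < #(N₁ v)}
  have hP : #P₁ + #P₂ = #S := card_filter_add_card_filter_not _
  have hcases : #S ≤ 2 * #P₁ ∨ #S ≤ 2 * #P₂ := by omega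
  -- In the first case some vertex gets the color of one of its neighbors. In the second, more than
  -- `D * s` vertices joined to some `v` through vertices outside `S` share the color of `v`.
  rcases hcases with hP₁ | hP₂
  · obtain ⟨L, hL, -, hmono⟩ := hD S P₁ N₁ hS (filter_subset _ _) hP₁
      (fun v _ => filter_subset _ _) (fun v hv => (mem_filter.1 hv).2.le)
    obtain ⟨c, -, hcL⟩ := hG L fun v => (hL v).ge
    obtain ⟨v, -, hv⟩ := hmono c hcL
    obtain ⟨w, hw⟩ := card_pos.1 hv
    obtain ⟨hw, hwc⟩ := mem_filter.1 hw
    exact c.valid (mem_filter.1 hw).2 hwc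
  · obtain ⟨L, hL, hLS, hmono⟩ := hk S P₂ N₂ hS (filter_subset _ _) hP₂
      (fun v _ => filter_subset _ _)
      (fun v hv => (hstuck v (mem_filter.1 hv).1 (not_lt.1 (mem_filter.1 hv).2)).le)
    obtain ⟨c, hc, hcL⟩ := hG L fun v => (hL v).ge
    obtain ⟨v, -, hv⟩ := hmono c hcL
    have hmid : ∀ w, ∃ x, w ∈ N₂ v → x ∉ S ∧ G.Adj w x ∧ G.Adj v x := by
      intro w
      by_cases hw : w ∈ N₂ v
      · obtain ⟨-, -, x, hx⟩ := mem_filter.1 hw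
        exact ⟨x, fun _ => hx⟩
      · exact ⟨w, fun h => absurd h hw⟩
    choose mid hmid using hmid
    set W := {w ∈ N₂ v | c w = c v} with hW
    have hWN : ∀ w ∈ W, w ∈ N₂ v := fun w hw => (mem_filter.1 hw).1
    -- Two distinct middle vertices of equal color would give the bicolored path `w, mid w, v, mid
    -- w'`.
    have himage : #(W.image mid) ≤ s := by
      rw [← card_range s]
      refine card_le_card_of_injOn c (fun x hx => ?_) fun x hx x' hx' hxx' => ?_
      · obtain ⟨w, hw, rfl⟩ := mem_image.1 hx
        have := hcL (mid w)
        rwa [hLS _ (hmid w (hWN w hw)).1] at this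
      · obtain ⟨w, hw, rfl⟩ := mem_image.1 hx
        obtain ⟨w', hw', rfl⟩ := mem_image.1 hx'
        by_contra hne
        obtain ⟨-, h1, h2⟩ := hmid w (hWN w hw)
        obtain ⟨-, -, h3⟩ := hmid w' (hWN w' hw')
        exact hc.no_bicolored_path h1 h2.symm h3 (mem_filter.1 (hWN w hw)).2.1 hne
          (mem_filter.1 hw).2 hxx'
    -- Vertices with the same middle vertex `x` are neighbors of `x` in `S`, and `x` was removed.
    have hfibre : ∀ x ∈ W.image mid, #{w ∈ W | mid w = x} ≤ D := by
      intro x hx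
      obtain ⟨w, hw, rfl⟩ := mem_image.1 hx
      refine (card_le_card fun u hu => ?_).trans (hSD _ (hmid w (hWN w hw)).1)
      obtain ⟨hu, hux⟩ := mem_filter.1 hu
      exact mem_filter.2 ⟨(mem_filter.1 (hWN u hu)).1, hux ▸ (hmid u (hWN u hu)).2.1⟩
    have := card_le_mul_card_image W D hfibre
    exact absurd (this.trans (Nat.mul_le_mul_left D himage)) (not_le.2 hv)

end Ordering

end SimpleGraph

theorem mainTheorem6 :
    (∀ F : Set FiniteGraph.{u}, HasBoundedStarChoiceNumber F ↔ HasBoundedArrangeability F) ∧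
      ∀ (G : FiniteGraph.{u}) (k : ℕ), G.graph.arrangeability ≤ k →
        G.graph.starChoiceNumber ≤ (k + 2) ^ 2 := by
  have bound : ∀ (G : FiniteGraph.{u}) (k : ℕ), G.graph.arrangeability ≤ k →
      G.graph.starChoiceNumber ≤ (k + 2) ^ 2 := fun G k h =>
    have := G.finite
    SimpleGraph.starChoiceNumber_le_iff.2 (SimpleGraph.arrangeability_le_iff.1 h).isStarChoosable
  refine ⟨fun F => ⟨?_, ?_⟩, bound⟩
  · rintro ⟨s, hs⟩
    -- The bound `s` may be zero, whereas the list construction needs nonempty lists; hence `s + 1`.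
    obtain ⟨k, hk⟩ := SimpleGraph.exists_hasArrangement_of_isStarChoosable.{u} s.succ_pos
    refine ⟨k, fun G hG => ?_⟩
    have := G.finite
    have h := SimpleGraph.starChoiceNumber_le_iff.1 (hs G hG)
    exact SimpleGraph.arrangeability_le_iff.2 (hk G.graph (h.mono s.le_succ))
  · rintro ⟨k, hk⟩
    exact ⟨(k + 2) ^ 2, fun G hG => bound G k (hk G hG)⟩
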